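/- Let $\epsilon,\Delta\in\mathbb R$, $\beta>0$, let $\hat\sigma_x,\hat\sigma_z$ be the Pauli matrices, $H_s=\epsilon\hat\sigma_z+\Delta\hat\sigma_x$, $W_s=\hat\sigma_z$, and let $O_s$ be a Hermitian $2\times2$ matrix. Let $\nu$ be a measure on $(0,\infty)$ (Lebesgue measure for a continuous bath, counting measure on the set of frequencies for a discrete one) and $J$ a real-valued spectral density such that $J(\omega)\coth(\beta\omega/2)$ is $\nu$-integrable on $(0,\infty)$. Define the following. - The two-point bath correlation, with $\Delta\tau=|\tau_1|-|\tau_2|$: $$B(\tau_1,\tau_2)=\frac1\pi\int_{(0,\infty)}J(\omega)\Big[\coth\Big(\frac{\beta\omega}2\Big)\cos(\omega\Delta\tau)-\mathrm i\sin(\omega\Delta\tau)\Big]\,\nu(\mathrm d\omega).$$ - The bath influence functional: $\mathcal L_b(s_1,\dots,s_m)=0$ for odd $m$, and for even $m$ $$\mathcal L_b(s_1,\dots,s_m)=\sum_{q}\prod_{(j,k)\in q}B(s_j,s_k),$$ where $q$ runs over the partitions of $\{1,\dots,m\}$ into pairs $(j,k)$, $j<k$. - The bare propagator, for $s_i\le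 s_f$: $G_s^{(0)}(s_i,s_f)=\mathrm e^{-\mathrm i(s_f-s_i)H_s}$ if $s_f<0$; $=\mathrm e^{-\mathrm i(s_i-s_f)H_s}$ if $0\le s_i$; $=\mathrm e^{\mathrm is_fH_s}O_s\mathrm e^{\mathrm is_iH_s}$ if $s_i<0\le s_f$. - The system functional, for $\boldsymbol s=(s_1,\dots,s_m)$: $$\mathcal U^{(0)}(-t,\boldsymbol s,t)=G_s^{(0)}(s_m,t)W_sG_s^{(0)}(s_{m-1},s_m)W_s\cdots W_sG_s^{(0)}(s_1,s_2)W_sG_s^{(0)}(-t,s_1).$$ - The time-ordered integral $$\int_{-t\le\boldsymbol s\le t}\mathrm d\boldsymbol s=\int_{-t}^t\mathrm ds_m\int_{-t}^{s_m}\mathrm ds_{m-1}\cdots\int_{-t}^{s_2}\mathrm ds_1,$$ and $\#\{\boldsymbol s<0\}$, the number of components of $\boldsymbol s$ that are less than $0$. - The propagator, given by its Dyson series $$G(-t,t)=\mathrm e^{\mathrm itH_s}O_s\mathrm e^{-\mathrm itH_s}+\sum_{m=1}^{\infty}\mathrm i^m\int_{-t\le\boldsymbol s\le t}\mathrm d\boldsymbol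 s\,(-1)^{\#\{\boldsymbol s<0\}}\,\mathcal U^{(0)}(-t,\boldsymbol s,t)\,\mathcal L_b(\boldsymbol s).$$ Put $\mathcal K(\boldsymbol s,t)=W_s\,\mathcal U^{(0)}(-t,\boldsymbol s,t)\,\mathcal L_b(\boldsymbol s,t)$, where $(\boldsymbol s,t)=(s_1,\dots,s_m,t)$. Then for every $t>0$ the Dyson series and the series below converge unconditionally, $\tau\mapsto G(-\tau,\tau)$ is differentiable at $t$, and $$\frac{\mathrm d}{\mathrm dt}G(-t,t)=\mathrm i\,[H_s,G(-t,t)]+\sum_{\substack{m\ge1\\ m\text{ odd}}}\mathrm i^{m+1}\int_{-t\le\boldsymbol s\le t}\mathrm d\boldsymbol s\,(-1)^{\#\{\boldsymbol s<0\}}\big(\mathcal K(\boldsymbol s,t)+\mathcal K(\boldsymbol s,t)^\dagger\big).$$ -/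

import Mathlib

open scoped Matrix.Norms.L2Operator

namespace SpinBoson

noncomputable section

/-- Operators on the two-dimensional system space `span {|0⟩, |1⟩}`, as matrices. -/
abbrev SysOp : Type := Matrix (Fin 2) (Fin 2) ℂ

/-- The Pauli matrix `σ_x`, with `σ_x |0⟩ = |1⟩` and `σ_x |1⟩ = |0⟩`. -/
def pauliX : SysOp := !![0, 1; 1, 0]

/-- The Pauli matrix `σ_z`, with `σ_z |0⟩ = |0⟩` and `σ_z |1⟩ = -|1⟩`. -/
def pauliZ : SysOp := !![1, 0; 0, -1]

/-- The system Hamiltonian `H_s = ε σ_z + Δ σ_x`. -/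
def sysHamiltonian (ε Δ : ℝ) : SysOp := (ε : ℂ) • pauliZ + (Δ : ℂ) • pauliX

/-- The system part `W_s = σ_z` of the coupling. -/
def sysCoupling : SysOp := pauliZ

/-- The bare propagator `G_s^{(0)}(si, sf)`, meant for `si ≤ sf`. -/
def bareProp (Hs Os : SysOp) (si sf : ℝ) : SysOp :=
  if sf < 0 then NormedSpace.exp ((-Complex.I * ((sf - si : ℝ) : ℂ)) • Hs)
  else if 0 ≤ si then NormedSpace.exp ((-Complex.I * ((si - sf : ℝ) : ℂ)) • Hs)
  else NormedSpace.exp ((Complex.I * (sf : ℂ)) • Hs) * Os *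
    NormedSpace.exp ((Complex.I * (si : ℂ)) • Hs)

/-- The system functional `U^{(0)}(si, s, sf)`, which is
`G(s_m, sf) W_s G(s_{m-1}, s_m) W_s ⋯ W_s G(s_1, s_2) W_s G(si, s_1)` with `G = G_s^{(0)}`,
by recursion on the number `m` of time points. -/
def sysFunctional (Hs Ws Os : SysOp) (si : ℝ) : (m : ℕ) → (Fin m → ℝ) → ℝ → SysOp
  | 0, _, sf => bareProp Hs Os si sf
  | m + 1, s, sf =>
      bareProp Hs Os (s (Fin.last m)) sf * Ws *
        sysFunctional Hs Ws Os si m (fun j => s j.castSucc) (s (Fin.last m))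

/-- The hyperbolic cotangent. -/
def coth (x : ℝ) : ℝ := Real.cosh x / Real.sinh x

/-- The function `B^*(x) = (1/π) ∫_0^∞ J(ω) [coth(βω/2) cos(ωx) - i sin(ωx)] ν(dω)`; here
`ν` is Lebesgue measure for a continuum of modes and a counting measure on the set of
frequencies for a discrete bath. -/
def bathCorrStar (β : ℝ) (ν : MeasureTheory.Measure ℝ) (J : ℝ → ℝ) (x : ℝ) : ℂ :=
  (1 / (Real.pi : ℂ)) * ∫ ω in Set.Ioi (0 : ℝ),
    (J ω : ℂ) * (((coth (β * ω / 2) * Real.cos (ω * x) : ℝ) : ℂ)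
      - Complex.I * ((Real.sin (ω * x) : ℝ) : ℂ)) ∂ν

/-- The two-point bath correlation `B(τ₁, τ₂) = B^*(|τ₁| - |τ₂|)`. -/
def bathCorr (β : ℝ) (ν : MeasureTheory.Measure ℝ) (J : ℝ → ℝ) (τ₁ τ₂ : ℝ) : ℂ :=
  bathCorrStar β ν J (|τ₁| - |τ₂|)

/-- The pairings of the index set `{1, …, m}`: sets of `m / 2` pairs `(j, k)` with `j < k`
whose entries exhaust the index set. -/
def pairings (m : ℕ) : Finset (Finset (Fin m × Fin m)) :=
  Finset.univ.filter fun q =>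
    q.card = m / 2 ∧ (∀ p ∈ q, p.1 < p.2) ∧ ∀ i : Fin m, ∃ p ∈ q, p.1 = i ∨ p.2 = i

/-- The bath influence functional `L_b(s_1, …, s_m)` of a two-point correlation `B`. -/
def bathFunctional (B : ℝ → ℝ → ℂ) {m : ℕ} (s : Fin m → ℝ) : ℂ :=
  if Odd m then 0 else ∑ q ∈ pairings m, ∏ p ∈ q, B (s p.1) (s p.2)

/-- The sequence `(s_1, …, s_m, x)`. -/
def appendTime {m : ℕ} (s : Fin m → ℝ) (x : ℝ) : Fin (m + 1) → ℝ :=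
  Fin.snoc (α := fun _ => ℝ) s x

/-- The sign `(-1)^{#{s < 0}}`. -/
def timeSign {m : ℕ} (s : Fin m → ℝ) : ℂ :=
  (-1) ^ (Finset.univ.filter fun j => s j < 0).card

/-- The time-ordered integral
`∫_{a ≤ s ≤ A} f(s) ds = ∫_a^A ds_m ∫_a^{s_m} ds_{m-1} ⋯ ∫_a^{s_2} ds_1 f(s_1, …, s_m)`. -/
def orderedIntegral (a : ℝ) : (m : ℕ) → ℝ → ((Fin m → ℝ) → SysOp) → SysOp
  | 0, _, f => f Fin.elim0
  | m + 1, A, f => ∫ x in a..A, orderedIntegral a m x fun s => f (appendTime s x)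

/-- The `m`-th term of the Dyson series of the propagator. -/
def dysonTerm (Hs Ws Os : SysOp) (B : ℝ → ℝ → ℂ) (m : ℕ) (t : ℝ) : SysOp :=
  Complex.I ^ m • orderedIntegral (-t) m t fun s =>
    timeSign s • (bathFunctional B s • sysFunctional Hs Ws Os (-t) m s t)

/-- The propagator `G(-t, t)`, given by its Dyson series (a sum over `m ≥ 1`). -/
def propagator (Hs Ws Os : SysOp) (B : ℝ → ℝ → ℂ) (t : ℝ) : SysOp :=
  NormedSpace.exp ((Complex.I * (t : ℂ)) • Hs) * Os *
      NormedSpace.exp ((-Complex.I * (t : ℂ)) • Hs)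
    + ∑' k : ℕ, dysonTerm Hs Ws Os B (k + 1) t

/-- The kernel `K(s, t) = W_s U^{(0)}(-t, s, t) L_b(s, t)`. -/
def kernelK (Hs Ws Os : SysOp) (B : ℝ → ℝ → ℂ) {m : ℕ} (s : Fin m → ℝ) (t : ℝ) : SysOp :=
  bathFunctional B (appendTime s t) • (Ws * sysFunctional Hs Ws Os (-t) m s t)

/-- The `m`-th term `i^{m+1} ∫_{-t ≤ s ≤ t} (-1)^{#{s < 0}} (K(s, t) + K(s, t)†) ds` of the
integro-differential equation. -/
def memoryTerm (Hs Ws Os : SysOp) (B : ℝ → ℝ → ℂ) (m : ℕ) (t : ℝ) : SysOp :=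
  Complex.I ^ (m + 1) • orderedIntegral (-t) m t fun s =>
    timeSign s • (kernelK Hs Ws Os B s t + (kernelK Hs Ws Os B s t).conjTranspose)

end

end SpinBoson

/-!
The derivation of the integro-differential equation rests on two observations.

*Interaction picture.* On time-ordered points the system functional factors as
`e^{itH} V(s) e^{-itH}`, where `V(s)` is the ordered product of the couplings
`e^{-i|s_j|H} W e^{i|s_j|H}` with the observable inserted at time `0`, and does not depend on `t`
(`sysFunctional_eq`). Conjugation by `e^{itH}` accounts for the commutator
(`hasDerivAt_evol_conj`). What is left to differentiate is a sum of integrals of fixed functions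
over the time-ordered points of `[-t, t]^m`.

*Folding.* In such a point the largest modulus is reached either at the last time or at the first,
and the time reversal `(s_1, …, s_m) ↦ (-s_m, …, -s_1)` exchanges the two cases
(`setIntegral_orderedSet_fold`). It takes the integrand to its adjoint
(`dysonIntegrand_timeReversal`): for the system part because `H`, `W` and `O` are Hermitian, for
the bath part because `B(-x, -y)` is the conjugate of `B(y, x)`, and for the sign because `m` is
even in every term that does not vanish. So, in the interaction picture, the `(m + 1)`-st Dyson
term is the integral of the `m`-th memory term over the largest modulus `x ∈ [0, t]`
(`interactionTerm_succ_eq_integral`). The memory term is continuous in `x > 0`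
(`continuousAt_interactionMemory`), and the fundamental theorem of calculus applies.

The series may be differentiated term by term because of a crude count of the pairings: a pairing
of `m` indices is a set of `m / 2` index pairs, and `choose (m ^ 2) (m / 2) ≤ e ^ m m! / (m / 2)!`,
whereas the set of time-ordered points has volume `(2t) ^ m / m!` (`summable_bathBound`,
`norm_orderedIntegral_le`).
-/

namespace SpinBoson

open MeasureTheory Filter Topology

noncomputable section

/-! ### The free evolution -/

/-- The unitary group `e^{iτH}` of the free system. -/
def evol (H : SysOp) (τ : ℝ) : SysOp := NormedSpace.exp ((Complex.I * (τ : ℂ)) • H)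

variable {H W O : SysOp}

lemma evol_add (a b : ℝ) : evol H (a + b) = evol H a * evol H b := by
  unfold evol
  rw [← Matrix.exp_add_of_commute]
  · congr 1
    push_cast
    rw [← add_smul]
    ring_nf
  · exact ((Commute.refl H).smul_left _).smul_right _

lemma evol_zero : evol H 0 = 1 := by
  simp [evol]

lemma evol_mul_evol_neg (a : ℝ) : evol H a * evol H (-a) = 1 := by
  rw [← evol_add, add_neg_cancel, evol_zero]

lemma evol_neg_mul_evol (a : ℝ) : evol H (-a) * evol H a = 1 := by
  rw [← evol_add, neg_add_cancel, evol_zero]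

lemma exp_neg_I_smul (a : ℝ) :
    NormedSpace.exp ((-Complex.I * (a : ℂ)) • H) = evol H (-a) := by
  unfold evol
  congr 2
  push_cast
  ring

lemma conjTranspose_evol (hH : H.IsHermitian) (a : ℝ) :
    (evol H a).conjTranspose = evol H (-a) := by
  unfold evol
  rw [← Matrix.exp_conjTranspose]
  congr 1
  rw [Matrix.conjTranspose_smul, hH.eq]
  congr 1
  simp

lemma norm_evol (hH : H.IsHermitian) (a : ℝ) : ‖evol H a‖ = 1 := by
  apply CStarRing.norm_of_mem_unitary
  rw [Unitary.mem_iff]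
  constructor
  · rw [Matrix.star_eq_conjTranspose, conjTranspose_evol hH, evol_neg_mul_evol]
  · rw [Matrix.star_eq_conjTranspose, conjTranspose_evol hH, evol_mul_evol_neg]

lemma evol_commute (a : ℝ) : H * evol H a = evol H a * H :=
  (((Commute.refl H).smul_right (Complex.I * (a : ℂ))).exp_right).eq

lemma hasDerivAt_evol (a : ℝ) : HasDerivAt (evol H) (Complex.I • (H * evol H a)) a := by
  have h := hasDerivAt_exp_smul_const' (𝕂 := ℝ) (Complex.I • H) a
  have e : ∀ u : ℝ, NormedSpace.exp (u • Complex.I • H) = evol H u := by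
    intro u
    unfold evol
    congr 1
    ext i j
    simp
    ring
  simp only [e] at h
  rwa [smul_mul_assoc] at h

lemma continuous_evol : Continuous (evol H) :=
  continuous_iff_continuousAt.2 fun a => (hasDerivAt_evol a).continuousAt

/-- Conjugation by the free evolution turns the commutator with `H` into a derivative. -/
lemma hasDerivAt_evol_conj {X : ℝ → SysOp} {X' : SysOp} {a : ℝ} (hX : HasDerivAt X X' a) :
    HasDerivAt (fun τ => evol H τ * X τ * evol H (-τ))
      (Complex.I • (H * (evol H a * X a * evol H (-a)) - evol H a * X a * evol H (-a) * H)
        + evol H a * X' * evol H (-a)) a := by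
  have h1 := (hasDerivAt_evol (H := H) a).mul hX
  have h2 : HasDerivAt (fun τ => evol H (-τ)) (-(Complex.I • (H * evol H (-a)))) a :=
    ((hasDerivAt_evol (H := H) (-a)).scomp a (hasDerivAt_neg a)).congr_deriv (by simp)
  refine (h1.mul h2).congr_deriv ?_
  rw [evol_commute (-a)]
  simp only [smul_sub, add_mul, smul_mul_assoc, mul_neg, mul_smul_comm, mul_assoc, Pi.mul_apply]
  abel

/-! ### The interaction picture -/

/-- The coupling `e^{-i|x|H} W e^{i|x|H}` in the interaction picture. -/
def coupling (H W : SysOp) (x : ℝ) : SysOp := evol H (-|x|) * W * evol H |x|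

/-- The coupling at nonnegative times, and `1` at negative ones. -/
def couplingPos (H W : SysOp) (x : ℝ) : SysOp := if 0 ≤ x then coupling H W x else 1

/-- The coupling at negative times, and `1` at nonnegative ones. -/
def couplingNeg (H W : SysOp) (x : ℝ) : SysOp := if x < 0 then coupling H W x else 1

/-- The ordered product `g(s_m) ⋯ g(s_1)`. -/
def orderedProd (g : ℝ → SysOp) : (m : ℕ) → (Fin m → ℝ) → SysOp
  | 0, _ => 1
  | m + 1, s => g (s (Fin.last m)) * orderedProd g m fun j => s j.castSucc

/-- The system functional in the interaction picture: the observable `O` stands between the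
couplings at nonnegative times and those at negative times. -/
def interactionFunctional (H W O : SysOp) (m : ℕ) (s : Fin m → ℝ) : SysOp :=
  orderedProd (couplingPos H W) m s * O * orderedProd (couplingNeg H W) m s

/-- The time reversal `(s_1, …, s_m) ↦ (-s_m, …, -s_1)`. -/
def timeReversal {m : ℕ} (s : Fin m → ℝ) : Fin m → ℝ := fun j => -s j.rev

lemma orderedProd_succ_front (g : ℝ → SysOp) (m : ℕ) (s : Fin (m + 1) → ℝ) :
    orderedProd g (m + 1) s = orderedProd g m (fun j => s j.succ) * g (s 0) := by
  induction m with
  | zero => simp [orderedProd]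
  | succ m ih =>
    rw [orderedProd, ih, orderedProd, mul_assoc]
    rfl

lemma conjTranspose_orderedProd {g h : ℝ → SysOp} (m : ℕ) (s : Fin m → ℝ)
    (hg : ∀ j, (g (s j)).conjTranspose = h (-s j)) :
    (orderedProd g m s).conjTranspose = orderedProd h m (timeReversal s) := by
  induction m with
  | zero => simp [orderedProd]
  | succ m ih =>
    rw [orderedProd, Matrix.conjTranspose_mul, ih _ fun j => hg _, hg, orderedProd_succ_front]
    simp only [timeReversal, Fin.rev_succ, Fin.rev_zero]
    rfl

lemma coupling_neg (x : ℝ) : coupling H W (-x) = coupling H W x := by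
  simp [coupling]

lemma conjTranspose_coupling (hH : H.IsHermitian) (hW : W.IsHermitian) (x : ℝ) :
    (coupling H W x).conjTranspose = coupling H W x := by
  simp [coupling, Matrix.conjTranspose_mul, conjTranspose_evol hH, hW.eq, mul_assoc]

/-- Time reversal takes the interaction functional to its adjoint. -/
lemma interactionFunctional_timeReversal (hH : H.IsHermitian) (hW : W.IsHermitian)
    (hO : O.IsHermitian) {m : ℕ} {s : Fin m → ℝ} (hs : ∀ j, s j ≠ 0) :
    interactionFunctional H W O m (timeReversal s)
      = (interactionFunctional H W O m s).conjTranspose := by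
  unfold interactionFunctional
  rw [Matrix.conjTranspose_mul, Matrix.conjTranspose_mul, hO.eq,
    conjTranspose_orderedProd (h := couplingPos H W), conjTranspose_orderedProd
      (h := couplingNeg H W), mul_assoc]
  · intro j
    unfold couplingPos couplingNeg
    rcases lt_or_gt_of_ne (hs j) with h | h
    · rw [if_neg (by linarith), if_neg (by linarith)]; simp
    · rw [if_pos (by linarith), if_pos (by linarith), conjTranspose_coupling hH hW, coupling_neg]
  · intro j
    unfold couplingPos couplingNeg
    rcases lt_or_gt_of_ne (hs j) with h | h
    · rw [if_pos (by linarith), if_pos (by linarith), conjTranspose_coupling hH hW, coupling_neg]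
    · rw [if_neg (by linarith), if_neg (by linarith)]; simp

lemma bareProp_of_neg {x y : ℝ} (h : y < 0) :
    bareProp H O x y = evol H (-y) * evol H x := by
  rw [bareProp, if_pos h, exp_neg_I_smul, ← evol_add]
  congr 1
  ring

lemma bareProp_of_nonneg {x y : ℝ} (hx : 0 ≤ x) (hy : 0 ≤ y) :
    bareProp H O x y = evol H y * evol H (-x) := by
  rw [bareProp, if_neg (not_lt.2 hy), if_pos hx, exp_neg_I_smul, ← evol_add]
  congr 1
  ring

lemma bareProp_of_neg_of_nonneg {x y : ℝ} (hx : x < 0) (hy : 0 ≤ y) :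
    bareProp H O x y = evol H y * O * evol H x := by
  rw [bareProp, if_neg (not_lt.2 hy), if_neg (not_le.2 hx)]
  rfl

lemma orderedProd_eq_one {g : ℝ → SysOp} (m : ℕ) (s : Fin m → ℝ) (h : ∀ j, g (s j) = 1) :
    orderedProd g m s = 1 := by
  induction m with
  | zero => rfl
  | succ m ih => rw [orderedProd, h, ih _ fun j => h _, one_mul]

/-- The factorization of the system functional up to an intermediate time `y`, where the
observable has been inserted only if `0 ≤ y`. -/
lemma sysFunctional_eq_of_le {t : ℝ} (ht : 0 < t) (m : ℕ) (s : Fin m → ℝ) (y : ℝ)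
    (hs : Monotone s) (hy : ∀ j, s j ≤ y) :
    sysFunctional H W O (-t) m s y = evol H |y| * (orderedProd (couplingPos H W) m s
      * (if 0 ≤ y then O else 1) * orderedProd (couplingNeg H W) m s) * evol H (-t) := by
  induction m generalizing y with
  | zero =>
    rw [sysFunctional]
    rcases lt_or_ge y 0 with h | h
    · rw [bareProp_of_neg h, if_neg (not_le.2 h), abs_of_neg h]
      simp [orderedProd]
    · rw [bareProp_of_neg_of_nonneg (by linarith) h, if_pos h, abs_of_nonneg h]
      simp [orderedProd]
  | succ m ih =>
    have hle : ∀ j : Fin m, s j.castSucc ≤ s (Fin.last m) := fun j => hs (Fin.le_last _)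
    rw [sysFunctional, ih _ _ (fun i j hij => hs (by simpa using hij)) hle, orderedProd,
      orderedProd]
    have hl := hy (Fin.last m)
    set x := s (Fin.last m)
    rcases lt_or_ge x 0 with hx | hx
    -- all times are negative, so there is no coupling at a nonnegative time
    · have h1 : orderedProd (couplingPos H W) m (fun j => s j.castSucc) = 1 :=
        orderedProd_eq_one _ _ fun j => if_neg (by linarith [hle j])
      rw [h1, if_neg (not_le.2 hx), couplingPos, if_neg (not_le.2 hx), couplingNeg, if_pos hx,
        coupling, abs_of_neg hx]
      rcases lt_or_ge y 0 with h | h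
      · rw [bareProp_of_neg h, if_neg (not_le.2 h), abs_of_neg h]
        simp [mul_assoc]
      · rw [bareProp_of_neg_of_nonneg hx h, if_pos h, abs_of_nonneg h]
        simp [mul_assoc]
    · have h : 0 ≤ y := hx.trans hl
      rw [if_pos hx, if_pos h, couplingPos, if_pos hx, couplingNeg, if_neg (not_lt.2 hx),
        coupling, abs_of_nonneg hx, abs_of_nonneg h, bareProp_of_nonneg hx h]
      simp [mul_assoc]

/-- On time-ordered points the system functional depends on the outer times `-t` and `t` only
through the conjugation by `e^{itH}`. -/
lemma sysFunctional_eq {t : ℝ} (ht : 0 < t) {m : ℕ} {s : Fin m → ℝ}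
    (hs : Monotone s) (hst : ∀ j, s j ≤ t) :
    sysFunctional H W O (-t) m s t
      = evol H t * interactionFunctional H W O m s * evol H (-t) := by
  rw [sysFunctional_eq_of_le ht m s t hs hst, if_pos ht.le, abs_of_pos ht, interactionFunctional]

lemma interactionFunctional_appendTime {m : ℕ} (s : Fin m → ℝ) {x : ℝ} (hx : 0 ≤ x) :
    interactionFunctional H W O (m + 1) (appendTime s x)
      = coupling H W x * interactionFunctional H W O m s := by
  simp [interactionFunctional, orderedProd, appendTime, couplingPos, couplingNeg, hx,
    not_lt.2 hx, mul_assoc]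

lemma continuous_coupling : Continuous (coupling H W) := by
  unfold coupling
  exact ((continuous_evol.comp (continuous_abs.neg)).mul continuous_const).mul
    (continuous_evol.comp continuous_abs)

lemma norm_coupling_le (hH : H.IsHermitian) (x : ℝ) : ‖coupling H W x‖ ≤ ‖W‖ := by
  unfold coupling
  refine (norm_mul_le _ _).trans ?_
  rw [norm_evol hH, mul_one]
  refine (norm_mul_le _ _).trans ?_
  rw [norm_evol hH, one_mul]

lemma norm_orderedProd_le {g : ℝ → SysOp} {w : ℝ} (hg : ∀ x, ‖g x‖ ≤ w)
    (m : ℕ) (s : Fin m → ℝ) : ‖orderedProd g m s‖ ≤ w ^ m := by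
  induction m with
  | zero => simp [orderedProd]
  | succ m ih =>
    rw [orderedProd, pow_succ']
    exact (norm_mul_le _ _).trans (mul_le_mul (hg _) (ih _) (norm_nonneg _)
      ((norm_nonneg _).trans (hg 0)))

lemma norm_interactionFunctional_le (hH : H.IsHermitian) (m : ℕ) (s : Fin m → ℝ) :
    ‖interactionFunctional H W O m s‖ ≤ ‖O‖ * (max 1 ‖W‖ ^ 2) ^ m := by
  have h1 : ∀ x, ‖couplingPos H W x‖ ≤ max 1 ‖W‖ := by
    intro x
    unfold couplingPos
    split_ifs
    · exact (norm_coupling_le hH x).trans (le_max_right _ _)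
    · simp
  have h2 : ∀ x, ‖couplingNeg H W x‖ ≤ max 1 ‖W‖ := by
    intro x
    unfold couplingNeg
    split_ifs
    · exact (norm_coupling_le hH x).trans (le_max_right _ _)
    · simp
  calc ‖interactionFunctional H W O m s‖
      ≤ max 1 ‖W‖ ^ m * ‖O‖ * max 1 ‖W‖ ^ m := by
        refine (norm_mul_le _ _).trans (mul_le_mul ((norm_mul_le _ _).trans ?_)
          (norm_orderedProd_le h2 m s) (norm_nonneg _) (by positivity))
        exact mul_le_mul_of_nonneg_right (norm_orderedProd_le h1 m s) (norm_nonneg _)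
    _ = ‖O‖ * (max 1 ‖W‖ ^ 2) ^ m := by ring

lemma stronglyMeasurable_orderedProd {g : ℝ → SysOp} (hg : StronglyMeasurable g) (m : ℕ) :
    StronglyMeasurable (orderedProd g m) := by
  induction m with
  | zero => exact stronglyMeasurable_const
  | succ m ih =>
    exact (hg.comp_measurable (measurable_pi_apply _)).mul
      (ih.comp_measurable (measurable_pi_lambda _ fun j => measurable_pi_apply _))

lemma stronglyMeasurable_interactionFunctional (m : ℕ) :
    StronglyMeasurable (interactionFunctional H W O m) := by
  refine ((stronglyMeasurable_orderedProd ?_ m).mul stronglyMeasurable_const).mul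
    (stronglyMeasurable_orderedProd ?_ m)
  · exact StronglyMeasurable.ite measurableSet_Ici continuous_coupling.stronglyMeasurable
      stronglyMeasurable_const
  · exact StronglyMeasurable.ite measurableSet_Iio continuous_coupling.stronglyMeasurable
      stronglyMeasurable_const

end

noncomputable section

/-! ### The bath influence functional -/

variable {B : ℝ → ℝ → ℂ} {C : ℝ} {m : ℕ}

lemma bathFunctional_of_odd (hm : Odd m) (s : Fin m → ℝ) : bathFunctional B s = 0 :=
  if_pos hm

/-- The reflection of an index pair, under which pairs stay increasing. -/
def revPair (p : Fin m × Fin m) : Fin m × Fin m := (p.2.rev, p.1.rev)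

lemma revPair_revPair (p : Fin m × Fin m) : revPair (revPair p) = p := by
  simp [revPair]

lemma revPair_injective : Function.Injective (revPair (m := m)) :=
  Function.LeftInverse.injective revPair_revPair

lemma image_revPair_mem_pairings {q : Finset (Fin m × Fin m)} (hq : q ∈ pairings m) :
    q.image revPair ∈ pairings m := by
  simp only [pairings, Finset.mem_filter, Finset.mem_univ, true_and] at hq ⊢
  obtain ⟨h1, h2, h3⟩ := hq
  refine ⟨by rw [Finset.card_image_of_injective _ revPair_injective, h1], ?_, ?_⟩
  · intro p hp
    obtain ⟨p', hp', rfl⟩ := Finset.mem_image.1 hp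
    exact Fin.rev_lt_rev.2 (h2 p' hp')
  · intro i
    obtain ⟨p, hp, h⟩ := h3 i.rev
    refine ⟨revPair p, Finset.mem_image_of_mem _ hp, ?_⟩
    rcases h with h | h
    · right; simp [revPair, h]
    · left; simp [revPair, h]

/-- If `B` is conjugated by time reversal, then so is the influence functional. -/
lemma bathFunctional_timeReversal (hB : ∀ x y, B (-x) (-y) = (starRingEnd ℂ) (B y x))
    (s : Fin m → ℝ) :
    bathFunctional B (timeReversal s) = (starRingEnd ℂ) (bathFunctional B s) := by
  unfold bathFunctional
  split_ifs with h
  · simp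
  rw [map_sum]
  refine Finset.sum_bij' (fun q _ => q.image revPair) (fun q _ => q.image revPair)
    (fun q hq => image_revPair_mem_pairings hq) (fun q hq => image_revPair_mem_pairings hq)
    ?_ ?_ ?_
  · intro q _
    simp [Finset.image_image, Function.comp_def, revPair_revPair]
  · intro q _
    simp [Finset.image_image, Function.comp_def, revPair_revPair]
  · intro q _
    rw [map_prod, Finset.prod_image revPair_injective.injOn]
    refine Finset.prod_congr rfl fun p _ => ?_
    simp only [timeReversal, revPair, hB]

lemma continuous_bathFunctional (hB : Continuous (Function.uncurry B)) :
    Continuous (fun s : Fin m → ℝ => bathFunctional B s) := by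
  unfold bathFunctional
  split_ifs
  · exact continuous_const
  · refine continuous_finsetSum _ fun q _ => continuous_finsetProd _ fun p _ => ?_
    exact hB.comp₂ (continuous_apply (A := fun _ : Fin m => ℝ) p.1)
      (continuous_apply (A := fun _ : Fin m => ℝ) p.2)

/-- A bound for the influence functional of `m` times when `‖B‖ ≤ C`: a pairing is a choice of
`m / 2` among the `m * m` index pairs. -/
def bathBound (C : ℝ) (m : ℕ) : ℝ :=
  if Odd m then 0 else ((m * m).choose (m / 2) : ℝ) * C ^ (m / 2)

lemma bathBound_nonneg (hC : 0 ≤ C) (m : ℕ) : 0 ≤ bathBound C m := by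
  unfold bathBound
  split_ifs
  · exact le_rfl
  · positivity

lemma card_pairings_le (m : ℕ) : (pairings m).card ≤ (m * m).choose (m / 2) := by
  have h : pairings m ⊆ Finset.powersetCard (m / 2) Finset.univ := by
    intro q hq
    simp only [pairings, Finset.mem_filter, Finset.mem_univ, true_and] at hq
    simp [Finset.mem_powersetCard, hq.1]
  refine (Finset.card_le_card h).trans ?_
  simp [Finset.card_powersetCard]

lemma norm_bathFunctional_le (hB : ∀ x y, ‖B x y‖ ≤ C) (s : Fin m → ℝ) :
    ‖bathFunctional B s‖ ≤ bathBound C m := by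
  have hC : 0 ≤ C := (norm_nonneg _).trans (hB 0 0)
  unfold bathFunctional bathBound
  split_ifs
  · simp
  refine (norm_sum_le _ _).trans ?_
  calc ∑ q ∈ pairings m, ‖∏ p ∈ q, B (s p.1) (s p.2)‖
      ≤ ∑ q ∈ pairings m, C ^ (m / 2) := by
        refine Finset.sum_le_sum fun q hq => ?_
        simp only [pairings, Finset.mem_filter, Finset.mem_univ, true_and] at hq
        rw [norm_prod, ← hq.1, ← Finset.prod_const]
        exact Finset.prod_le_prod (fun p _ => norm_nonneg _) fun p _ => hB _ _
    _ = (pairings m).card * C ^ (m / 2) := by simp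
    _ ≤ _ := by
        refine mul_le_mul_of_nonneg_right ?_ (by positivity)
        exact_mod_cast card_pairings_le m

/-- The influence functional grows like `(m / 2)!` up to a geometric factor, since
`choose (m ^ 2) (m / 2) ≤ m ^ m / (m / 2)!` and `m ^ m ≤ e ^ m m!`. -/
lemma summable_bathBound (hC : 0 ≤ C) {a : ℝ} (ha : 0 ≤ a) :
    Summable fun m : ℕ => bathBound C m * a ^ m / (m.factorial : ℝ) := by
  have hodd : ∀ k : ℕ, bathBound C (2 * k + 1) * a ^ (2 * k + 1) / ((2 * k + 1).factorial : ℝ)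
      = 0 := by
    intro k
    rw [bathBound, if_pos ⟨k, rfl⟩]
    simp
  have heven : Summable fun k : ℕ =>
      bathBound C (2 * k) * a ^ (2 * k) / ((2 * k).factorial : ℝ) := by
    refine Summable.of_nonneg_of_le (fun k => ?_) (fun k => ?_)
      (Real.summable_pow_div_factorial ((Real.exp 1 * a) ^ 2 * C))
    · have := bathBound_nonneg hC (2 * k)
      positivity
    · have hf : (0 : ℝ) < (2 * k).factorial := by positivity
      have hk : (0 : ℝ) < k.factorial := by positivity
      have h1 : (((2 * k) * (2 * k)).choose k : ℝ)
          ≤ ((2 * k : ℕ) : ℝ) ^ (2 * k) / k.factorial := by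
        refine (Nat.choose_le_pow_div (α := ℝ) k ((2 * k) * (2 * k))).trans (le_of_eq ?_)
        push_cast
        rw [pow_mul, sq]
      have h2 : ((2 * k : ℕ) : ℝ) ^ (2 * k) ≤ Real.exp 1 ^ (2 * k) * (2 * k).factorial := by
        have := Real.pow_div_factorial_le_exp ((2 * k : ℕ) : ℝ) (by positivity) (2 * k)
        rw [div_le_iff₀ hf] at this
        rwa [← Real.exp_nat_mul, mul_one]
      rw [bathBound, if_neg (by simp), Nat.mul_div_cancel_left k two_pos, div_le_iff₀ hf]
      calc (((2 * k) * (2 * k)).choose k : ℝ) * C ^ k * a ^ (2 * k)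
          ≤ (Real.exp 1 ^ (2 * k) * (2 * k).factorial / k.factorial) * C ^ k * a ^ (2 * k) := by
            gcongr
            exact h1.trans (by gcongr)
        _ = _ := by
            rw [mul_pow, ← pow_mul, mul_pow]
            ring
  refine HasSum.summable (HasSum.even_add_odd heven.hasSum (m' := 0) ?_)
  simp only [hodd]
  exact hasSum_zero

lemma summable_bathBound_succ (hC : 0 ≤ C) {w T : ℝ} (hw : 0 ≤ w) (hT : 0 ≤ T) :
    Summable fun m : ℕ => bathBound C (m + 1) * w ^ (m + 1) * (T ^ m / (m.factorial : ℝ)) := by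
  refine Summable.of_nonneg_of_le (fun m => ?_) (fun m => ?_)
    ((summable_nat_add_iff 1).2 (summable_bathBound hC (a := 2 * w * (T + 1)) (by positivity)))
  · have := bathBound_nonneg hC (m + 1)
    positivity
  · have h0 := bathBound_nonneg hC (m + 1)
    have h1 : ((m : ℝ) + 1) ≤ 2 ^ (m + 1) := by exact_mod_cast (Nat.lt_two_pow_self (n := m + 1)).le
    have h2 : T ^ m ≤ (T + 1) ^ (m + 1) :=
      (pow_le_pow_left₀ hT (by linarith) m).trans (pow_le_pow_right₀ (by linarith) m.le_succ)
    rw [Nat.factorial_succ, Nat.cast_mul, mul_pow, mul_pow, le_div_iff₀ (by positivity)]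
    have hm : (0 : ℝ) < m.factorial := by positivity
    calc bathBound C (m + 1) * w ^ (m + 1) * (T ^ m / (m.factorial : ℝ))
          * (((m + 1 : ℕ) : ℝ) * (m.factorial : ℝ))
        = bathBound C (m + 1) * w ^ (m + 1) * (((m : ℝ) + 1) * T ^ m) := by
          push_cast
          field_simp
      _ ≤ bathBound C (m + 1) * w ^ (m + 1) * (2 ^ (m + 1) * (T + 1) ^ (m + 1)) := by gcongr
      _ = _ := by ring

/-! ### The two-point correlation of a bath -/

section Correlation

variable {β : ℝ} {ν : Measure ℝ} {J : ℝ → ℝ}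

lemma one_le_coth {x : ℝ} (hx : 0 < x) : 1 ≤ coth x := by
  have h := Real.sinh_pos_iff.2 hx
  rw [coth, le_div_iff₀ h, one_mul]
  exact Real.sinh_lt_cosh x |>.le

/-- The integrand of the two-point correlation. -/
def corrIntegrand (β : ℝ) (J : ℝ → ℝ) (x ω : ℝ) : ℂ :=
  (J ω : ℂ) * (((coth (β * ω / 2) * Real.cos (ω * x) : ℝ) : ℂ)
      - Complex.I * ((Real.sin (ω * x) : ℝ) : ℂ))

lemma bathCorrStar_eq (x : ℝ) : bathCorrStar β ν J x
    = (1 / (Real.pi : ℂ)) * ∫ ω in Set.Ioi (0 : ℝ), corrIntegrand β J x ω ∂ν := rfl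

lemma norm_corrIntegrand_le (hβ : 0 < β) {ω : ℝ} (hω : 0 < ω) (x : ℝ) :
    ‖corrIntegrand β J x ω‖ ≤ 2 * ‖J ω * coth (β * ω / 2)‖ := by
  have h1 := one_le_coth (x := β * ω / 2) (by positivity)
  have hc := Real.abs_cos_le_one (ω * x)
  have hs := Real.abs_sin_le_one (ω * x)
  rw [corrIntegrand, norm_mul, Complex.norm_real, norm_mul]
  have h2 : ‖((coth (β * ω / 2) * Real.cos (ω * x) : ℝ) : ℂ)
      - Complex.I * ((Real.sin (ω * x) : ℝ) : ℂ)‖ ≤ 2 * ‖coth (β * ω / 2)‖ := by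
    refine (norm_sub_le _ _).trans ?_
    rw [norm_mul, Complex.norm_I, one_mul, Complex.norm_real, Complex.norm_real, norm_mul,
      Real.norm_eq_abs, Real.norm_eq_abs, Real.norm_eq_abs, abs_of_pos (by linarith : 0 < coth _)]
    nlinarith
  calc _ ≤ ‖J ω‖ * (2 * ‖coth (β * ω / 2)‖) := by gcongr
    _ = _ := by ring

lemma continuousOn_coth : ContinuousOn coth (Set.Ioi 0) := by
  unfold coth
  exact Real.continuous_cosh.continuousOn.div Real.continuous_sinh.continuousOn
    fun x hx => (Real.sinh_pos_iff.2 hx).ne'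

/-- Since `coth` is continuous and positive on the positive half-line, measurability of
`J coth` gives that of `J`. -/
lemma aestronglyMeasurable_corrIntegrand (hβ : 0 < β)
    (hJ : IntegrableOn (fun ω => J ω * coth (β * ω / 2)) (Set.Ioi 0) ν) (x : ℝ) :
    AEStronglyMeasurable (corrIntegrand β J x) (ν.restrict (Set.Ioi 0)) := by
  have hc : ContinuousOn (fun ω : ℝ => coth (β * ω / 2)) (Set.Ioi 0) :=
    continuousOn_coth.comp (by fun_prop) fun ω hω => by
      simp only [Set.mem_Ioi] at hω ⊢
      positivity
  have hpos : ∀ ω ∈ Set.Ioi (0 : ℝ), coth (β * ω / 2) ≠ 0 := fun ω hω => by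
    have hω' : 0 < ω := hω
    linarith [one_le_coth (x := β * ω / 2) (by positivity)]
  have hJm : AEStronglyMeasurable J (ν.restrict (Set.Ioi 0)) := by
    refine (hJ.aestronglyMeasurable.mul
      ((hc.inv₀ hpos).aestronglyMeasurable measurableSet_Ioi)).congr ?_
    filter_upwards [ae_restrict_mem measurableSet_Ioi] with ω hω
    simp [hpos ω hω]
  have h1 : ContinuousOn (fun ω : ℝ => ((coth (β * ω / 2) * Real.cos (ω * x) : ℝ) : ℂ)
      - Complex.I * ((Real.sin (ω * x) : ℝ) : ℂ)) (Set.Ioi 0) := by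
    refine ContinuousOn.sub (Complex.continuous_ofReal.comp_continuousOn
      (hc.mul (by fun_prop))) (by fun_prop)
  exact (Complex.continuous_ofReal.comp_aestronglyMeasurable hJm).mul
    (h1.aestronglyMeasurable measurableSet_Ioi)

lemma continuous_bathCorrStar (hβ : 0 < β)
    (hJ : IntegrableOn (fun ω => J ω * coth (β * ω / 2)) (Set.Ioi 0) ν) :
    Continuous (bathCorrStar β ν J) := by
  simp only [funext (bathCorrStar_eq (β := β) (ν := ν) (J := J))]
  refine continuous_const.mul (continuous_of_dominated
    (aestronglyMeasurable_corrIntegrand hβ hJ) (fun x => ?_) (hJ.norm.const_mul 2) ?_)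
  · filter_upwards [ae_restrict_mem measurableSet_Ioi] with ω hω
    exact norm_corrIntegrand_le hβ hω x
  · refine ae_of_all _ fun ω => ?_
    unfold corrIntegrand
    fun_prop

lemma norm_bathCorrStar_le (hβ : 0 < β)
    (hJ : IntegrableOn (fun ω => J ω * coth (β * ω / 2)) (Set.Ioi 0) ν) (x : ℝ) :
    ‖bathCorrStar β ν J x‖ ≤ ‖1 / (Real.pi : ℂ)‖
      * ∫ ω in Set.Ioi (0 : ℝ), 2 * ‖J ω * coth (β * ω / 2)‖ ∂ν := by
  rw [bathCorrStar_eq, norm_mul]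
  refine mul_le_mul_of_nonneg_left (norm_integral_le_of_norm_le (hJ.norm.const_mul 2) ?_)
    (norm_nonneg _)
  filter_upwards [ae_restrict_mem measurableSet_Ioi] with ω hω
  exact norm_corrIntegrand_le hβ hω x

lemma bathCorrStar_neg (x : ℝ) :
    bathCorrStar β ν J (-x) = (starRingEnd ℂ) (bathCorrStar β ν J x) := by
  rw [bathCorrStar_eq, bathCorrStar_eq, map_mul, ← integral_conj]
  congr 1
  · simp
  · refine integral_congr_ae (ae_of_all _ fun ω => ?_)
    simp [corrIntegrand, -Complex.ofReal_cos, -Complex.ofReal_sin]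

lemma bathCorr_neg (x y : ℝ) :
    bathCorr β ν J (-x) (-y) = (starRingEnd ℂ) (bathCorr β ν J y x) := by
  rw [bathCorr, bathCorr, ← bathCorrStar_neg, abs_neg, abs_neg, neg_sub]

lemma continuous_bathCorr (hβ : 0 < β)
    (hJ : IntegrableOn (fun ω => J ω * coth (β * ω / 2)) (Set.Ioi 0) ν) :
    Continuous (Function.uncurry (bathCorr β ν J)) :=
  (continuous_bathCorrStar hβ hJ).comp
    ((continuous_abs.comp continuous_fst).sub (continuous_abs.comp continuous_snd))

end Correlation

end

noncomputable section

/-! ### Time-ordered integrals -/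

/-- The time-ordered points of `[a, A]^m`. -/
def orderedSet (m : ℕ) (a A : ℝ) : Set (Fin m → ℝ) :=
  {s | Monotone s ∧ ∀ j, s j ∈ Set.Icc a A}

variable {m : ℕ} {a A t : ℝ} {f g : (Fin m → ℝ) → SysOp} {M : ℝ}

lemma indicator_eq_indicator_of_iff {α β : Type*} {S : Set α} {T : Set β} {p : α → SysOp}
    {q : β → SysOp} {x : α} {y : β} (h : x ∈ S ↔ y ∈ T) (hpq : p x = q y) :
    S.indicator p x = T.indicator q y := by
  by_cases hy : y ∈ T
  · rw [Set.indicator_of_mem hy, Set.indicator_of_mem (h.2 hy), hpq]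
  · rw [Set.indicator_of_notMem hy, Set.indicator_of_notMem (mt h.1 hy)]

lemma appendTime_last (s : Fin m → ℝ) (x : ℝ) : appendTime s x (Fin.last m) = x := by
  simp [appendTime]

lemma appendTime_castSucc (s : Fin m → ℝ) (x : ℝ) (j : Fin m) :
    appendTime s x j.castSucc = s j := by
  simp [appendTime]

lemma monotone_appendTime {s : Fin m → ℝ} {x : ℝ} :
    Monotone (appendTime s x) ↔ Monotone s ∧ ∀ j, s j ≤ x := by
  constructor
  · intro h
    refine ⟨fun i j hij => ?_, fun j => ?_⟩
    · simpa [appendTime_castSucc] using h (Fin.castSucc_le_castSucc_iff.2 hij)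
    · simpa [appendTime_castSucc, appendTime_last] using h (Fin.le_last j.castSucc)
  · rintro ⟨h, hx⟩ i j hij
    induction j using Fin.lastCases with
    | last =>
      induction i using Fin.lastCases with
      | last => exact le_rfl
      | cast i => simpa [appendTime_castSucc, appendTime_last] using hx i
    | cast j =>
      induction i using Fin.lastCases with
      | last => exact absurd hij (not_le.2 (Fin.castSucc_lt_last j))
      | cast i =>
        simpa [appendTime_castSucc] using h (Fin.castSucc_le_castSucc_iff.1 hij)

lemma forall_appendTime {p : ℝ → Prop} {s : Fin m → ℝ} {x : ℝ} :
    (∀ j, p (appendTime s x j)) ↔ (∀ j, p (s j)) ∧ p x := by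
  rw [Fin.forall_fin_succ']
  simp [appendTime_castSucc, appendTime_last]

lemma appendTime_mem_orderedSet {s : Fin m → ℝ} {x : ℝ} :
    appendTime s x ∈ orderedSet (m + 1) a A ↔ x ∈ Set.Icc a A ∧ s ∈ orderedSet m a x := by
  simp only [orderedSet, Set.mem_ofPred_eq, monotone_appendTime]
  rw [forall_appendTime (p := fun y => y ∈ Set.Icc a A)]
  constructor
  · rintro ⟨⟨h1, h2⟩, h3, h4⟩
    exact ⟨h4, h1, fun j => ⟨(h3 j).1, h2 j⟩⟩
  · rintro ⟨h4, h1, h2⟩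
    exact ⟨⟨h1, fun j => (h2 j).2⟩, fun j => ⟨(h2 j).1, (h2 j).2.trans h4.2⟩, h4⟩

lemma measurableSet_orderedSet : MeasurableSet (orderedSet m a A) := by
  have h : {s : Fin m → ℝ | ∀ j, s j ∈ Set.Icc a A} = ⋂ j, {s | s j ∈ Set.Icc a A} := by
    ext s
    simp
  have h' : MeasurableSet {s : Fin m → ℝ | ∀ j, s j ∈ Set.Icc a A} := by
    rw [h]
    exact MeasurableSet.iInter fun j => measurable_pi_apply j measurableSet_Icc
  exact isClosed_monotone.measurableSet.inter h'

lemma orderedSet_subset_Icc : orderedSet m a A ⊆ Set.Icc (fun _ => a) (fun _ => A) :=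
  fun _ hs => ⟨fun j => (hs.2 j).1, fun j => (hs.2 j).2⟩

lemma integrableOn_orderedSet (hf : StronglyMeasurable f) (hM : ∀ s, ‖f s‖ ≤ M) :
    IntegrableOn f (orderedSet m a A) :=
  Measure.integrableOn_of_bounded
    ((measure_mono orderedSet_subset_Icc).trans_lt isCompact_Icc.measure_lt_top).ne
    hf.aestronglyMeasurable (ae_of_all _ hM)

lemma continuous_appendTime : Continuous fun p : ℝ × (Fin m → ℝ) => appendTime p.2 p.1 :=
  Continuous.finSnoc (A := fun _ => ℝ) continuous_snd continuous_fst

lemma continuous_appendTime_left (x : ℝ) : Continuous fun s : Fin m → ℝ => appendTime s x :=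
  continuous_appendTime.comp (continuous_const.prodMk continuous_id)

lemma measurePreserving_appendTime :
    MeasurePreserving (fun p : ℝ × (Fin m → ℝ) => appendTime p.2 p.1) volume volume := by
  have h := (volume_preserving_piFinSuccAbove (fun _ : Fin (m + 1) => ℝ) (Fin.last m)).symm
  have e : (fun p : ℝ × (Fin m → ℝ) => appendTime p.2 p.1)
      = (MeasurableEquiv.piFinSuccAbove (fun _ : Fin (m + 1) => ℝ) (Fin.last m)).symm := by
    funext p
    rw [MeasurableEquiv.piFinSuccAbove_symm_apply]
    exact (Fin.insertNth_last' p.1 p.2).symm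
  rw [e]
  exact h

lemma integrable_comp_appendTime {g : (Fin (m + 1) → ℝ) → SysOp} (hg : Integrable g) :
    Integrable (fun p : ℝ × (Fin m → ℝ) => g (appendTime p.2 p.1))
      ((volume : Measure ℝ).prod volume) :=
  measurePreserving_appendTime.integrable_comp_of_integrable hg

/-- Fubini's theorem for the last of `m + 1` times. -/
lemma integral_eq_integral_appendTime {g : (Fin (m + 1) → ℝ) → SysOp} (hg : Integrable g) :
    ∫ s, g s = ∫ x, ∫ s, g (appendTime s x) := by
  have hp := measurePreserving_appendTime (m := m)
  rw [← hp.map_eq, integral_map hp.measurable.aemeasurable, Measure.volume_eq_prod,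
    integral_prod _ (integrable_comp_appendTime hg)]
  rw [hp.map_eq]
  exact hg.aestronglyMeasurable

/-- The iterated integral is the integral over the set of time-ordered points. -/
lemma orderedIntegral_eq_setIntegral (h : a ≤ A) (hf : StronglyMeasurable f)
    (hM : ∀ s, ‖f s‖ ≤ M) : orderedIntegral a m A f = ∫ s in orderedSet m a A, f s := by
  induction m generalizing A with
  | zero =>
    have h1 : orderedSet 0 a A = Set.univ :=
      Set.eq_univ_of_forall fun s => ⟨fun i => i.elim0, fun i => i.elim0⟩
    rw [orderedIntegral, h1, Measure.restrict_univ, volume_pi, Measure.pi_of_empty _ Fin.elim0,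
      integral_dirac]
  | succ m ih =>
    rw [orderedIntegral, ← integral_indicator measurableSet_orderedSet,
      integral_eq_integral_appendTime ((integrableOn_orderedSet hf hM).integrable_indicator
        measurableSet_orderedSet), intervalIntegral.integral_of_le h,
      ← integral_Icc_eq_integral_Ioc, ← integral_indicator measurableSet_Icc]
    refine integral_congr_ae (ae_of_all _ fun x => ?_)
    by_cases hx : x ∈ Set.Icc a A
    · simp only [Set.indicator_of_mem hx]
      rw [ih (f := fun s => f (appendTime s x)) hx.1
        (hf.comp_measurable (continuous_appendTime_left x).measurable) fun _ => hM _,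
        ← integral_indicator measurableSet_orderedSet]
      exact integral_congr_ae (ae_of_all _ fun s => indicator_eq_indicator_of_iff
        (appendTime_mem_orderedSet.trans (and_iff_right hx)).symm rfl)
    · simp only [Set.indicator, appendTime_mem_orderedSet, hx, false_and, if_false, integral_zero]

lemma orderedIntegral_congr (h : a ≤ A) (hfg : ∀ s ∈ orderedSet m a A, f s = g s) :
    orderedIntegral a m A f = orderedIntegral a m A g := by
  induction m generalizing A with
  | zero => exact hfg _ ⟨fun i => i.elim0, fun i => i.elim0⟩
  | succ m ih =>
    rw [orderedIntegral, orderedIntegral]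
    refine intervalIntegral.integral_congr fun x hx => ?_
    rw [Set.uIcc_of_le h] at hx
    exact ih hx.1 fun s hs => hfg _ (appendTime_mem_orderedSet.2 ⟨hx, hs⟩)

lemma norm_orderedIntegral_le (h : a ≤ A) (hM : ∀ s, ‖f s‖ ≤ M) :
    ‖orderedIntegral a m A f‖ ≤ M * ((A - a) ^ m / (m.factorial : ℝ)) := by
  induction m generalizing A with
  | zero => simpa [orderedIntegral] using hM _
  | succ m ih =>
    rw [orderedIntegral]
    refine (intervalIntegral.norm_integral_le_of_norm_le h
      (g := fun x => M * ((x - a) ^ m / (m.factorial : ℝ)))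
      (ae_of_all _ fun x hx => ih hx.1.le fun s => hM _)
      (Continuous.intervalIntegrable (by fun_prop) _ _)).trans (le_of_eq ?_)
    rw [intervalIntegral.integral_const_mul, intervalIntegral.integral_div,
      intervalIntegral.integral_comp_sub_right (fun x => x ^ m), integral_pow, sub_self,
      Nat.factorial_succ]
    have : (m.factorial : ℝ) ≠ 0 := by positivity
    push_cast
    field_simp
    simp

lemma orderedIntegral_mul_mul (h : a ≤ A) (hf : StronglyMeasurable f)
    (hM : ∀ s, ‖f s‖ ≤ M) (P Q : SysOp) :
    orderedIntegral a m A (fun s => P * f s * Q) = P * orderedIntegral a m A f * Q := by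
  have hM' : ∀ s, ‖P * f s * Q‖ ≤ ‖P‖ * M * ‖Q‖ := fun s =>
    (norm_mul_le _ _).trans (mul_le_mul_of_nonneg_right ((norm_mul_le _ _).trans
      (mul_le_mul_of_nonneg_left (hM s) (norm_nonneg _))) (norm_nonneg _))
  rw [orderedIntegral_eq_setIntegral (f := fun s => P * f s * Q) h
    ((stronglyMeasurable_const.mul hf).mul stronglyMeasurable_const) hM',
    orderedIntegral_eq_setIntegral h hf hM]
  exact ((ContinuousLinearMap.mulLeftRight ℝ SysOp P Q).integral_comp_comm
    (integrableOn_orderedSet hf hM))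

/-! ### Folding along time reversal -/

lemma timeReversal_timeReversal (s : Fin m → ℝ) : timeReversal (timeReversal s) = s := by
  funext j
  simp [timeReversal]

lemma measurePreserving_timeReversal :
    MeasurePreserving (timeReversal (m := m)) volume volume := by
  have h1 := volume_measurePreserving_piCongrLeft (fun _ : Fin m => ℝ) Fin.revPerm
  convert (Measure.measurePreserving_neg (volume : Measure (Fin m → ℝ))).comp h1 using 1
  funext s j
  simp only [timeReversal, Function.comp_apply, Pi.neg_apply]
  congr 1
  have := MeasurableEquiv.piCongrLeft_apply_apply (β := fun _ : Fin m => ℝ) Fin.revPerm s j.rev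
  simpa using this.symm

lemma measurableEmbedding_timeReversal : MeasurableEmbedding (timeReversal (m := m)) :=
  (MeasurableEquiv.ofInvolutive timeReversal timeReversal_timeReversal
    measurePreserving_timeReversal.measurable).measurableEmbedding

lemma timeReversal_mem_orderedSet {s : Fin m → ℝ} :
    timeReversal s ∈ orderedSet m (-t) t ↔ s ∈ orderedSet m (-t) t := by
  have key : ∀ s : Fin m → ℝ, s ∈ orderedSet m (-t) t → timeReversal s ∈ orderedSet m (-t) t := by
    rintro s ⟨h1, h2⟩
    refine ⟨fun i j hij => neg_le_neg (h1 (Fin.rev_le_rev.2 hij)), fun j => ?_⟩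
    have := h2 j.rev
    exact ⟨neg_le_neg this.2, neg_le.1 this.1⟩
  exact ⟨fun h => timeReversal_timeReversal s ▸ key _ h, key s⟩

/-- The time-ordered points of `[-t, t]^(m+1)` whose last time has the largest modulus. -/
def lastDominant (m : ℕ) (t : ℝ) : Set (Fin (m + 1) → ℝ) :=
  {s | s ∈ orderedSet (m + 1) (-t) t ∧ -s (Fin.last m) ≤ s 0}

lemma measurableSet_lastDominant : MeasurableSet (lastDominant m t) :=
  measurableSet_orderedSet.inter
    (measurableSet_le (measurable_pi_apply _).neg (measurable_pi_apply _))

lemma appendTime_mem_lastDominant {s : Fin m → ℝ} {x : ℝ} :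
    appendTime s x ∈ lastDominant m t ↔ x ∈ Set.Icc 0 t ∧ s ∈ orderedSet m (-x) x := by
  simp only [lastDominant, Set.mem_ofPred_eq, appendTime_last, appendTime_mem_orderedSet]
  constructor
  · rintro ⟨⟨h1, h2, h3⟩, h4⟩
    have hmono : Monotone (appendTime s x) := monotone_appendTime.2 ⟨h2, fun j => (h3 j).2⟩
    have h5 : ∀ j, -x ≤ appendTime s x j := fun j => h4.trans (hmono (Fin.zero_le j))
    have h6 := h5 (Fin.last m)
    rw [appendTime_last] at h6
    refine ⟨⟨by linarith, h1.2⟩, h2, fun j => ⟨?_, (h3 j).2⟩⟩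
    simpa [appendTime_castSucc] using h5 j.castSucc
  · rintro ⟨h1, h2, h3⟩
    refine ⟨⟨⟨by linarith [h1.1, h1.2], h1.2⟩, h2, fun j => ⟨by linarith [(h3 j).1, h1.2],
      (h3 j).2⟩⟩, ?_⟩
    exact (forall_appendTime (p := fun y => -x ≤ y)).2 ⟨fun j => (h3 j).1, by linarith [h1.1]⟩ 0

lemma volume_add_eq_zero (i j : Fin m) : volume {s : Fin m → ℝ | s i + s j = 0} = 0 := by
  let l : (Fin m → ℝ) →ₗ[ℝ] ℝ := LinearMap.proj (R := ℝ) (φ := fun _ => ℝ) i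
    + LinearMap.proj (R := ℝ) (φ := fun _ => ℝ) j
  have h := Measure.addHaar_submodule (volume : Measure (Fin m → ℝ)) (LinearMap.ker l) ?_
  · exact h
  · intro htop
    have : (fun _ => 1 : Fin m → ℝ) ∈ LinearMap.ker l := htop ▸ Submodule.mem_top
    norm_num [l, LinearMap.mem_ker] at this

/-- Time reversal exchanges the points where the last time has the largest modulus and those
where the first has. -/
lemma setIntegral_orderedSet_eq_lastDominant {f : (Fin (m + 1) → ℝ) → SysOp}
    (hf : StronglyMeasurable f) (hM : ∀ s, ‖f s‖ ≤ M) :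
    ∫ s in orderedSet (m + 1) (-t) t, f s
      = ∫ s in lastDominant m t, (f s + f (timeReversal s)) := by
  have hfi : IntegrableOn f (orderedSet (m + 1) (-t) t) := integrableOn_orderedSet hf hM
  have hgi : IntegrableOn (fun s => f (timeReversal s)) (orderedSet (m + 1) (-t) t) :=
    integrableOn_orderedSet (hf.comp_measurable measurePreserving_timeReversal.measurable)
      fun _ => hM _
  have hsub : lastDominant m t ⊆ orderedSet (m + 1) (-t) t := fun _ h => h.1
  rw [integral_add (hfi.mono_set hsub) (hgi.mono_set hsub),
    ← integral_inter_add_sdiff measurableSet_lastDominant hfi, Set.inter_eq_right.2 hsub]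
  congr 1
  -- the two cases overlap where the first and the last time are opposite, a null set
  have h1 : (orderedSet (m + 1) (-t) t \ lastDominant m t : Set _)
      =ᵐ[volume] timeReversal ⁻¹' lastDominant m t := by
    filter_upwards [compl_mem_ae_iff.2 (volume_add_eq_zero (0 : Fin (m + 1)) (Fin.last m))]
      with s hs
    apply propext
    change s ∈ orderedSet (m + 1) (-t) t \ lastDominant m t ↔ timeReversal s ∈ lastDominant m t
    have hs' : s 0 + s (Fin.last m) ≠ 0 := hs
    simp only [lastDominant, Set.mem_sdiff, Set.mem_ofPred_eq, timeReversal_mem_orderedSet,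
      not_and, timeReversal, Fin.rev_last, Fin.rev_zero, neg_neg]
    constructor
    · rintro ⟨h, h'⟩
      have := h' h
      exact ⟨h, by linarith⟩
    · rintro ⟨h, h'⟩
      refine ⟨h, fun _ h'' => hs' (by linarith)⟩
  rw [setIntegral_congr_set h1]
  have h2 := measurePreserving_timeReversal.setIntegral_preimage_emb
    measurableEmbedding_timeReversal (fun s => f (timeReversal s)) (lastDominant m t)
  simpa only [timeReversal_timeReversal] using h2

/-- Folding: an integral over the ordered points of `[-t, t]^(m+1)` is an integral over the
largest modulus `x` of the times, reached either at the last time or at the first. -/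
lemma setIntegral_orderedSet_fold {f : (Fin (m + 1) → ℝ) → SysOp}
    (hf : StronglyMeasurable f) (hM : ∀ s, ‖f s‖ ≤ M) (ht : 0 ≤ t) :
    IntervalIntegrable (fun x => ∫ s in orderedSet m (-x) x,
      (f (appendTime s x) + f (timeReversal (appendTime s x)))) volume 0 t ∧
    ∫ s in orderedSet (m + 1) (-t) t, f s = ∫ x in 0..t, ∫ s in orderedSet m (-x) x,
      (f (appendTime s x) + f (timeReversal (appendTime s x))) := by
  set g : (Fin (m + 1) → ℝ) → SysOp := fun s => f s + f (timeReversal s)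
  have hg : StronglyMeasurable g :=
    hf.add (hf.comp_measurable measurePreserving_timeReversal.measurable)
  have hgM : ∀ s, ‖g s‖ ≤ M + M := fun s => (norm_add_le _ _).trans (add_le_add (hM _) (hM _))
  have hi : Integrable ((lastDominant m t).indicator g) :=
    IntegrableOn.integrable_indicator ((integrableOn_orderedSet hg hgM).mono_set
      fun _ h => h.1) measurableSet_lastDominant
  have key : (fun x => ∫ s, (lastDominant m t).indicator g (appendTime s x))
      = (Set.Icc 0 t).indicator fun x => ∫ s in orderedSet m (-x) x, g (appendTime s x) := by
    funext x
    by_cases hx : x ∈ Set.Icc 0 t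
    · rw [Set.indicator_of_mem hx, ← integral_indicator measurableSet_orderedSet]
      exact integral_congr_ae (ae_of_all _ fun s => indicator_eq_indicator_of_iff
        (appendTime_mem_lastDominant.trans (and_iff_right hx)) rfl)
    · simp only [Set.indicator, appendTime_mem_lastDominant, hx, false_and, if_false,
        integral_zero]
  constructor
  · rw [intervalIntegrable_iff_integrableOn_Icc_of_le ht,
      ← integrable_indicator_iff measurableSet_Icc, ← key]
    exact (integrable_comp_appendTime hi).integral_prod_left
  · rw [setIntegral_orderedSet_eq_lastDominant hf hM,
      ← integral_indicator measurableSet_lastDominant, integral_eq_integral_appendTime hi, key,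
      integral_indicator measurableSet_Icc, intervalIntegral.integral_of_le ht,
      integral_Icc_eq_integral_Ioc]

end

noncomputable section

/-! ### The sign of a time sequence -/

lemma timeSign_eq_prod {m : ℕ} (s : Fin m → ℝ) :
    timeSign s = ∏ j, if s j < 0 then (-1 : ℂ) else 1 := by
  rw [timeSign, Finset.prod_ite]
  simp

lemma timeSign_appendTime {m : ℕ} (s : Fin m → ℝ) {x : ℝ} (hx : 0 ≤ x) :
    timeSign (appendTime s x) = timeSign s := by
  rw [timeSign_eq_prod, timeSign_eq_prod, Fin.prod_univ_castSucc]
  simp [appendTime_castSucc, appendTime_last, not_lt.2 hx]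

lemma timeSign_timeReversal {m : ℕ} (hm : Even m) {s : Fin m → ℝ} (hs : ∀ j, s j ≠ 0) :
    timeSign (timeReversal s) = timeSign s := by
  rw [timeSign_eq_prod, timeSign_eq_prod,
    ← Equiv.prod_comp Fin.revPerm fun j => if timeReversal s j < 0 then (-1 : ℂ) else 1]
  have h : ∀ j, (if timeReversal s (Fin.revPerm j) < 0 then (-1 : ℂ) else 1)
      = -1 * if s j < 0 then (-1 : ℂ) else 1 := by
    intro j
    simp only [timeReversal, Fin.revPerm_apply, Fin.rev_rev]
    rcases lt_or_gt_of_ne (hs j) with h | h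
    · rw [if_neg (by linarith), if_pos h]; norm_num
    · rw [if_pos (by linarith), if_neg (by linarith)]; norm_num
  simp only [h, Finset.prod_mul_distrib, Finset.prod_const, Finset.card_univ, Fintype.card_fin,
    hm.neg_one_pow, one_mul]

lemma star_timeSign {m : ℕ} (s : Fin m → ℝ) : star (timeSign s) = timeSign s := by
  simp [timeSign]

lemma norm_timeSign {m : ℕ} (s : Fin m → ℝ) : ‖timeSign s‖ = 1 := by
  simp [timeSign]

lemma stronglyMeasurable_timeSign (m : ℕ) : StronglyMeasurable (timeSign (m := m)) := by
  have h : (timeSign (m := m)) = fun s => ∏ j, if s j < 0 then (-1 : ℂ) else 1 :=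
    funext timeSign_eq_prod
  rw [h]
  refine Measurable.stronglyMeasurable (Finset.measurable_fun_prod _ fun j _ => ?_)
  exact Measurable.ite (measurable_pi_apply j measurableSet_Iio) measurable_const measurable_const

/-! ### The Dyson series in the interaction picture -/

/-- A two-point function that is continuous, bounded by `C`, and conjugated by time reversal. -/
structure IsBathCorrelation (B : ℝ → ℝ → ℂ) (C : ℝ) : Prop where
  continuous : Continuous (Function.uncurry B)
  norm_le : ∀ x y, ‖B x y‖ ≤ C
  neg : ∀ x y, B (-x) (-y) = (starRingEnd ℂ) (B y x)

/-- The integrand of the Dyson series in the interaction picture; it does not involve the outer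
time. -/
def dysonIntegrand (H W O : SysOp) (B : ℝ → ℝ → ℂ) {m : ℕ} (s : Fin m → ℝ) : SysOp :=
  timeSign s • (bathFunctional B s • interactionFunctional H W O m s)

/-- The integrand of the memory term in the interaction picture: the largest modulus `x` is
reached at the last time or, after time reversal, at the first. -/
def memoryIntegrand (H W O : SysOp) (B : ℝ → ℝ → ℂ) {m : ℕ} (x : ℝ) (s : Fin m → ℝ) : SysOp :=
  dysonIntegrand H W O B (appendTime s x)
    + (dysonIntegrand H W O B (appendTime s x)).conjTranspose

/-- The `m`-th term of the Dyson series in the interaction picture. -/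
def interactionTerm (H W O : SysOp) (B : ℝ → ℝ → ℂ) (m : ℕ) (t : ℝ) : SysOp :=
  Complex.I ^ m • orderedIntegral (-t) m t (dysonIntegrand H W O B)

/-- The `m`-th memory term in the interaction picture. -/
def interactionMemory (H W O : SysOp) (B : ℝ → ℝ → ℂ) (m : ℕ) (t : ℝ) : SysOp :=
  Complex.I ^ (m + 1) • orderedIntegral (-t) m t (memoryIntegrand H W O B t)

/-- A bound for `dysonIntegrand`. -/
def dysonBound (W O : SysOp) (C : ℝ) (m : ℕ) : ℝ :=
  ‖O‖ * (bathBound C m * (max 1 ‖W‖ ^ 2) ^ m)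

variable {H W O : SysOp} {B : ℝ → ℝ → ℂ} {C : ℝ} {m : ℕ} {t : ℝ}

lemma IsBathCorrelation.nonneg (hB : IsBathCorrelation B C) : 0 ≤ C :=
  (norm_nonneg _).trans (hB.norm_le 0 0)

lemma norm_dysonIntegrand_le (hH : H.IsHermitian) (hB : IsBathCorrelation B C)
    (s : Fin m → ℝ) : ‖dysonIntegrand H W O B s‖ ≤ dysonBound W O C m := by
  rw [dysonIntegrand, norm_smul, norm_smul, norm_timeSign, one_mul]
  refine (mul_le_mul (norm_bathFunctional_le hB.norm_le s)
    (norm_interactionFunctional_le hH m s) (norm_nonneg _)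
    (bathBound_nonneg hB.nonneg m)).trans (le_of_eq ?_)
  rw [dysonBound]
  ring

lemma stronglyMeasurable_dysonIntegrand (hB : IsBathCorrelation B C) :
    StronglyMeasurable (dysonIntegrand H W O B (m := m)) :=
  (stronglyMeasurable_timeSign m).smul
    ((continuous_bathFunctional hB.continuous).stronglyMeasurable.smul
      (stronglyMeasurable_interactionFunctional m))

lemma norm_memoryIntegrand_le (hH : H.IsHermitian) (hB : IsBathCorrelation B C) (x : ℝ)
    (s : Fin m → ℝ) : ‖memoryIntegrand H W O B x s‖ ≤ 2 * dysonBound W O C (m + 1) := by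
  refine (norm_add_le _ _).trans ?_
  rw [Matrix.l2_opNorm_conjTranspose]
  linarith [norm_dysonIntegrand_le (W := W) (O := O) hH hB (appendTime s x)]

lemma continuous_conjTranspose :
    Continuous (Matrix.conjTranspose : SysOp → SysOp) :=
  continuous_id.matrix_conjTranspose

lemma stronglyMeasurable_memoryIntegrand (hB : IsBathCorrelation B C) (x : ℝ) :
    StronglyMeasurable (memoryIntegrand H W O B x (m := m)) := by
  have h := (stronglyMeasurable_dysonIntegrand (H := H) (W := W) (O := O) (m := m + 1)
    hB).comp_measurable (continuous_appendTime_left x).measurable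
  exact h.add (continuous_conjTranspose.comp_stronglyMeasurable h)

lemma dysonIntegrand_timeReversal (hH : H.IsHermitian) (hW : W.IsHermitian)
    (hO : O.IsHermitian) (hB : IsBathCorrelation B C) {s : Fin m → ℝ} (hs : ∀ j, s j ≠ 0) :
    dysonIntegrand H W O B (timeReversal s)
      = (dysonIntegrand H W O B s).conjTranspose := by
  rw [dysonIntegrand, dysonIntegrand, Matrix.conjTranspose_smul, Matrix.conjTranspose_smul,
    star_timeSign, interactionFunctional_timeReversal hH hW hO hs,
    bathFunctional_timeReversal hB.neg]
  rcases Nat.even_or_odd m with hm | hm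
  · rw [timeSign_timeReversal hm hs]
    rfl
  · simp [bathFunctional_of_odd hm]

lemma dysonTerm_eq (hH : H.IsHermitian) (hB : IsBathCorrelation B C) (ht : 0 < t) (m : ℕ) :
    dysonTerm H W O B m t = evol H t * interactionTerm H W O B m t * evol H (-t) := by
  rw [dysonTerm, interactionTerm, mul_smul_comm, smul_mul_assoc,
    ← orderedIntegral_mul_mul (by linarith) (stronglyMeasurable_dysonIntegrand hB)
      (norm_dysonIntegrand_le hH hB)]
  congr 1
  refine orderedIntegral_congr (by linarith) fun s hs => ?_
  rw [sysFunctional_eq ht hs.1 fun j => (hs.2 j).2, dysonIntegrand]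
  simp only [mul_smul_comm, smul_mul_assoc]

lemma dysonIntegrand_appendTime (s : Fin m → ℝ) {x : ℝ} (hx : 0 ≤ x) :
    dysonIntegrand H W O B (appendTime s x) = timeSign s • (bathFunctional B (appendTime s x) •
      (coupling H W x * interactionFunctional H W O m s)) := by
  rw [dysonIntegrand, timeSign_appendTime s hx, interactionFunctional_appendTime s hx]

lemma memoryTerm_eq (hH : H.IsHermitian) (hB : IsBathCorrelation B C) (ht : 0 < t) (m : ℕ) :
    memoryTerm H W O B m t = evol H t * interactionMemory H W O B m t * evol H (-t) := by
  rw [memoryTerm, interactionMemory, mul_smul_comm, smul_mul_assoc,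
    ← orderedIntegral_mul_mul (by linarith) (stronglyMeasurable_memoryIntegrand hB t)
      (norm_memoryIntegrand_le hH hB t)]
  congr 1
  refine orderedIntegral_congr (by linarith) fun s hs => ?_
  have h1 : evol H t * dysonIntegrand H W O B (appendTime s t) * evol H (-t)
      = timeSign s • kernelK H W O B s t := by
    rw [kernelK, sysFunctional_eq ht hs.1 fun j => (hs.2 j).2,
      dysonIntegrand_appendTime s ht.le, coupling, abs_of_pos ht]
    simp only [mul_smul_comm, smul_mul_assoc]
    congr 2
    simp only [← mul_assoc, evol_mul_evol_neg, one_mul]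
  have h2 : evol H t * (dysonIntegrand H W O B (appendTime s t)).conjTranspose * evol H (-t)
      = timeSign s • (kernelK H W O B s t).conjTranspose := by
    have h := congrArg Matrix.conjTranspose h1
    rw [Matrix.conjTranspose_mul, Matrix.conjTranspose_mul, Matrix.conjTranspose_smul,
      star_timeSign, conjTranspose_evol hH, conjTranspose_evol hH, neg_neg, ← mul_assoc] at h
    exact h
  rw [memoryIntegrand, mul_add, add_mul, h1, h2, smul_add]

/-! ### Differentiation of the Dyson terms -/

lemma ae_forall_ne (c : ℝ) : ∀ᵐ s : Fin m → ℝ, ∀ j, s j ≠ c :=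
  ae_all_iff.2 fun j => by
    rw [ae_iff]
    simpa [volume_pi] using Measure.pi_hyperplane (fun _ => (volume : Measure ℝ)) j c

/-- Folding along time reversal, for the Dyson terms. -/
lemma interactionTerm_succ_eq_integral (hH : H.IsHermitian) (hW : W.IsHermitian)
    (hO : O.IsHermitian) (hB : IsBathCorrelation B C) (ht : 0 ≤ t) (m : ℕ) :
    IntervalIntegrable (fun x => interactionMemory H W O B m x) volume 0 t ∧
    interactionTerm H W O B (m + 1) t = ∫ x in 0..t, interactionMemory H W O B m x := by
  obtain ⟨h1, h2⟩ := setIntegral_orderedSet_fold (stronglyMeasurable_dysonIntegrand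
    (H := H) (W := W) (O := O) (m := m + 1) hB) (norm_dysonIntegrand_le hH hB) ht
  have key : ∀ x ∈ Set.Ioc 0 t, Complex.I ^ (m + 1) • (∫ s in orderedSet m (-x) x,
      (dysonIntegrand H W O B (appendTime s x)
        + dysonIntegrand H W O B (timeReversal (appendTime s x))))
      = interactionMemory H W O B m x := by
    intro x hx
    rw [interactionMemory, orderedIntegral_eq_setIntegral (by linarith [hx.1])
      (stronglyMeasurable_memoryIntegrand hB x) (norm_memoryIntegrand_le hH hB x)]
    congr 1
    refine integral_congr_ae (ae_restrict_of_ae ?_)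
    filter_upwards [ae_forall_ne 0] with s hs
    rw [memoryIntegrand, dysonIntegrand_timeReversal hH hW hO hB
      ((forall_appendTime (p := fun y => y ≠ 0)).2 ⟨hs, hx.1.ne'⟩)]
  constructor
  · refine (h1.smul (Complex.I ^ (m + 1))).congr ?_
    intro x hx
    rw [Set.uIoc_of_le ht] at hx
    exact key x hx
  · rw [interactionTerm, orderedIntegral_eq_setIntegral (by linarith)
      (stronglyMeasurable_dysonIntegrand hB) (norm_dysonIntegrand_le hH hB), h2,
      ← intervalIntegral.integral_smul]
    refine intervalIntegral.integral_congr_ae (ae_of_all _ fun x hx => ?_)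
    rw [Set.uIoc_of_le ht] at hx
    exact key x hx

lemma continuousAt_memoryIntegrand (hB : IsBathCorrelation B C) (ht : 0 < t) (s : Fin m → ℝ) :
    ContinuousAt (fun x => memoryIntegrand H W O B x s) t := by
  have h : ContinuousAt (fun x => dysonIntegrand H W O B (appendTime s x)) t := by
    have hc : Continuous fun x => timeSign s • (bathFunctional B (appendTime s x) •
        (coupling H W x * interactionFunctional H W O m s)) := by
      have h1 : Continuous fun x => bathFunctional B (appendTime s x) :=
        (continuous_bathFunctional hB.continuous).comp (continuous_appendTime.comp
          (continuous_id.prodMk continuous_const))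
      have h2 : Continuous (coupling H W) := continuous_coupling
      fun_prop
    refine hc.continuousAt.congr ?_
    filter_upwards [lt_mem_nhds ht] with x hx
    exact (dysonIntegrand_appendTime s hx.le).symm
  exact h.add (continuous_conjTranspose.continuousAt.comp h)

/-- The moving boundary of the set of ordered points does no harm, since a fixed point with
`|s_j| ≠ t` for all `j` stays inside or outside the set for times near `t`. -/
lemma continuousAt_interactionMemory (hH : H.IsHermitian) (hB : IsBathCorrelation B C)
    (ht : 0 < t) (m : ℕ) : ContinuousAt (interactionMemory H W O B m) t := by
  have hc : ContinuousAt (fun x => ∫ s, (orderedSet m (-x) x).indicator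
      (memoryIntegrand H W O B x) s) t := by
    have hbox : MeasurableSet (Set.Icc (fun _ : Fin m => -(t + 1)) (fun _ => t + 1)) :=
      isClosed_Icc.measurableSet
    refine continuousAt_of_dominated (bound :=
      (Set.Icc (fun _ : Fin m => -(t + 1)) (fun _ => t + 1)).indicator
        fun _ => 2 * dysonBound W O C (m + 1)) ?_ ?_ ?_ ?_
    · exact Eventually.of_forall fun x => ((stronglyMeasurable_memoryIntegrand hB x).indicator
        measurableSet_orderedSet).aestronglyMeasurable
    · filter_upwards [gt_mem_nhds (show t < t + 1 by linarith)] with x hx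
      refine ae_of_all _ fun s => ?_
      by_cases hs : s ∈ orderedSet m (-x) x
      · have hs' : s ∈ Set.Icc (fun _ : Fin m => -(t + 1)) (fun _ => t + 1) :=
          ⟨fun j => by linarith [(hs.2 j).1], fun j => by linarith [(hs.2 j).2]⟩
        rw [Set.indicator_of_mem hs, Set.indicator_of_mem hs']
        exact norm_memoryIntegrand_le hH hB x s
      · rw [Set.indicator_of_notMem hs, norm_zero]
        refine Set.indicator_nonneg (fun s _ => ?_) s
        exact (norm_nonneg _).trans (norm_memoryIntegrand_le (W := W) (O := O) hH hB x s)
    · exact (integrable_indicator_iff hbox).2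
        (integrableOn_const isCompact_Icc.measure_lt_top.ne)
    · filter_upwards [ae_forall_ne t, ae_forall_ne (-t)] with s hs hs'
      by_cases hin : s ∈ orderedSet m (-t) t
      · have hev : ∀ᶠ x in 𝓝 t, s ∈ orderedSet m (-x) x := by
          have : ∀ᶠ x in 𝓝 t, ∀ j, s j ∈ Set.Icc (-x) x := by
            refine eventually_all.2 fun j => ?_
            have h1 : s j < t := lt_of_le_of_ne (hin.2 j).2 (hs j)
            have h2 : -s j < t := by
              have := lt_of_le_of_ne (hin.2 j).1 (hs' j).symm
              linarith
            filter_upwards [lt_mem_nhds h1, lt_mem_nhds h2] with x hx1 hx2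
            exact ⟨by linarith, hx1.le⟩
          filter_upwards [this] with x hx
          exact ⟨hin.1, hx⟩
        refine (continuousAt_memoryIntegrand (H := H) (W := W) (O := O) hB ht s).congr ?_
        filter_upwards [hev] with x hx
        exact (Set.indicator_of_mem hx _).symm
      · have hev : ∀ᶠ x in 𝓝 t, s ∉ orderedSet m (-x) x := by
          by_cases hmono : Monotone s
          · have : ∃ j, s j ∉ Set.Icc (-t) t := by
              by_contra! h
              exact hin ⟨hmono, h⟩
            obtain ⟨j, hj⟩ := this
            have hopen : ∀ᶠ x in 𝓝 t, x < max (s j) (-s j) := by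
              refine gt_mem_nhds ?_
              by_contra! h
              exact hj ⟨by linarith [(max_le_iff.1 h).2], (max_le_iff.1 h).1⟩
            filter_upwards [hopen] with x hx h
            exact absurd (max_le (h.2 j).2 (by linarith [(h.2 j).1])) (not_le.2 hx)
          · exact Eventually.of_forall fun x h => hmono h.1
        refine (continuousAt_const (y := (0 : SysOp))).congr ?_
        filter_upwards [hev] with x hx
        exact (Set.indicator_of_notMem hx _).symm
  refine (hc.const_smul (Complex.I ^ (m + 1))).congr ?_
  filter_upwards [lt_mem_nhds ht] with x hx
  rw [Pi.smul_apply, interactionMemory, orderedIntegral_eq_setIntegral (by linarith)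
    (stronglyMeasurable_memoryIntegrand hB x) (norm_memoryIntegrand_le hH hB x),
    integral_indicator measurableSet_orderedSet]

lemma hasDerivAt_interactionTerm (hH : H.IsHermitian) (hW : W.IsHermitian)
    (hO : O.IsHermitian) (hB : IsBathCorrelation B C) (ht : 0 < t) (m : ℕ) :
    HasDerivAt (interactionTerm H W O B (m + 1)) (interactionMemory H W O B m t) t := by
  have hcont : ContinuousOn (interactionMemory H W O B m) (Set.Ioi 0) := fun x hx =>
    (continuousAt_interactionMemory hH hB hx m).continuousWithinAt
  have h := intervalIntegral.integral_hasDerivAt_right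
    (interactionTerm_succ_eq_integral hH hW hO hB ht.le m).1
    (hcont.stronglyMeasurableAtFilter isOpen_Ioi t ht)
    (continuousAt_interactionMemory hH hB ht m)
  refine h.congr_of_eventuallyEq ?_
  filter_upwards [lt_mem_nhds ht] with x hx
  exact (interactionTerm_succ_eq_integral hH hW hO hB hx.le m).2

/-! ### Convergence of the series -/

lemma norm_interactionTerm_le (hH : H.IsHermitian) (hB : IsBathCorrelation B C) (ht : 0 ≤ t)
    (m : ℕ) : ‖interactionTerm H W O B m t‖
      ≤ dysonBound W O C m * ((2 * t) ^ m / (m.factorial : ℝ)) := by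
  rw [interactionTerm, norm_smul, norm_pow, Complex.norm_I, one_pow, one_mul]
  refine (norm_orderedIntegral_le (by linarith) (norm_dysonIntegrand_le hH hB)).trans
    (le_of_eq ?_)
  ring

lemma norm_interactionMemory_le (hH : H.IsHermitian) (hB : IsBathCorrelation B C) (ht : 0 ≤ t)
    (m : ℕ) : ‖interactionMemory H W O B m t‖
      ≤ 2 * dysonBound W O C (m + 1) * ((2 * t) ^ m / (m.factorial : ℝ)) := by
  rw [interactionMemory, norm_smul, norm_pow, Complex.norm_I, one_pow, one_mul]
  refine (norm_orderedIntegral_le (by linarith) (norm_memoryIntegrand_le hH hB t)).trans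
    (le_of_eq ?_)
  ring

lemma summable_dysonBound (hC : 0 ≤ C) {T : ℝ} (hT : 0 ≤ T) :
    Summable fun m : ℕ => 2 * dysonBound W O C (m + 1) * (T ^ m / (m.factorial : ℝ)) := by
  refine ((summable_bathBound_succ hC (w := max 1 ‖W‖ ^ 2) (by positivity) hT).mul_left
    (2 * ‖O‖)).congr fun m => ?_
  rw [dysonBound]
  ring

lemma summable_interactionTerm (hH : H.IsHermitian) (hB : IsBathCorrelation B C) (ht : 0 ≤ t) :
    Summable fun k : ℕ => interactionTerm H W O B (k + 1) t := by
  have h := (summable_nat_add_iff 1).2 ((summable_bathBound hB.nonneg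
    (a := max 1 ‖W‖ ^ 2 * (2 * t)) (by positivity)).mul_left ‖O‖)
  refine Summable.of_norm_bounded h fun k => ?_
  refine (norm_interactionTerm_le hH hB ht (k + 1)).trans (le_of_eq ?_)
  rw [dysonBound]
  ring

lemma summable_interactionMemory (hH : H.IsHermitian) (hB : IsBathCorrelation B C)
    (ht : 0 ≤ t) : Summable fun k : ℕ => interactionMemory H W O B k t :=
  Summable.of_norm_bounded (summable_dysonBound hB.nonneg (by positivity : 0 ≤ 2 * t))
    fun k => norm_interactionMemory_le hH hB ht k

lemma hasDerivAt_tsum_interactionTerm (hH : H.IsHermitian) (hW : W.IsHermitian)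
    (hO : O.IsHermitian) (hB : IsBathCorrelation B C) (ht : 0 < t) :
    HasDerivAt (fun τ => ∑' k : ℕ, interactionTerm H W O B (k + 1) τ)
      (∑' k : ℕ, interactionMemory H W O B k t) t := by
  have hmem : t ∈ Set.Ioo 0 (t + 1) := ⟨ht, by linarith⟩
  refine hasDerivAt_tsum_of_isPreconnected
    (summable_dysonBound (W := W) (O := O) hB.nonneg (by positivity : 0 ≤ 2 * (t + 1)))
    isOpen_Ioo isPreconnected_Ioo
    (fun k τ hτ => hasDerivAt_interactionTerm hH hW hO hB hτ.1 k) (fun k τ hτ => ?_) hmem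
    (summable_interactionTerm hH hB ht.le) hmem
  refine (norm_interactionMemory_le hH hB hτ.1.le k).trans ?_
  have h0 : 0 ≤ 2 * dysonBound W O C (k + 1) :=
    (norm_nonneg _).trans (norm_memoryIntegrand_le (m := k) hH hB 0 0)
  have h1 : (0 : ℝ) ≤ 2 * τ := by linarith [hτ.1]
  have h2 : 2 * τ ≤ 2 * (t + 1) := by linarith [hτ.2]
  gcongr

lemma summable_dysonTerm (hH : H.IsHermitian) (hB : IsBathCorrelation B C) (ht : 0 < t) :
    Summable fun k : ℕ => dysonTerm H W O B (k + 1) t := by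
  simp only [dysonTerm_eq hH hB ht]
  exact ((summable_interactionTerm hH hB ht.le).mul_left _).mul_right _

lemma summable_memoryTerm (hH : H.IsHermitian) (hB : IsBathCorrelation B C) (ht : 0 < t) :
    Summable fun k : ℕ => memoryTerm H W O B k t := by
  simp only [memoryTerm_eq hH hB ht]
  exact ((summable_interactionMemory hH hB ht.le).mul_left _).mul_right _

/-- For even `m` the influence functional in the memory term has an odd number of times. -/
lemma memoryTerm_of_not_odd (hm : ¬ Odd m) (t : ℝ) : memoryTerm H W O B m t = 0 := by
  have hK : ∀ s : Fin m → ℝ, kernelK H W O B s t = 0 := fun s => by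
    rw [kernelK, bathFunctional_of_odd (Nat.not_odd_iff_even.1 hm).add_one, zero_smul]
  have hz : ∀ (k : ℕ) (a A : ℝ), orderedIntegral a k A (fun _ => 0) = 0 := by
    intro k
    induction k with
    | zero => intro a A; rfl
    | succ k ih => intro a A; simp [orderedIntegral, ih]
  simp [memoryTerm, hK, hz]

lemma propagator_eq (hH : H.IsHermitian) (hB : IsBathCorrelation B C) (ht : 0 < t) :
    propagator H W O B t
      = evol H t * (O + ∑' k : ℕ, interactionTerm H W O B (k + 1) t) * evol H (-t) := by
  have hs := summable_interactionTerm (W := W) (O := O) hH hB ht.le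
  rw [propagator, exp_neg_I_smul, mul_add, add_mul]
  simp only [dysonTerm_eq hH hB ht]
  rw [(hs.mul_left _).tsum_mul_right, hs.tsum_mul_left]
  rfl

/-- The integro-differential equation for Hermitian `H`, `W`, `O` and any two-point function that
is continuous, bounded and conjugated by time reversal. -/
theorem hasDerivAt_propagator (hH : H.IsHermitian) (hW : W.IsHermitian)
    (hO : O.IsHermitian) (hB : IsBathCorrelation B C) (ht : 0 < t) :
    HasDerivAt (propagator H W O B)
      (Complex.I • (H * propagator H W O B t - propagator H W O B t * H)
        + ∑' m : {m : ℕ // Odd m}, memoryTerm H W O B m t) t := by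
  have hs := summable_interactionMemory (W := W) (O := O) hH hB ht.le
  have h := hasDerivAt_evol_conj (H := H)
    ((hasDerivAt_tsum_interactionTerm hH hW hO hB ht).const_add O)
  refine (h.congr_of_eventuallyEq ?_).congr_deriv ?_
  · filter_upwards [lt_mem_nhds ht] with τ hτ
    exact propagator_eq hH hB hτ
  · have hsupp : Function.support (fun m : ℕ => memoryTerm H W O B m t) ⊆ {m | Odd m} :=
      fun m hm => by
        by_contra h
        exact hm (memoryTerm_of_not_odd h t)
    have hsum : ∑' m : {m : ℕ // Odd m}, memoryTerm H W O B m t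
        = ∑' m : ℕ, memoryTerm H W O B m t := tsum_subtype_eq_of_support_subset hsupp
    rw [hsum, propagator_eq hH hB ht]
    simp only [memoryTerm_eq hH hB ht]
    rw [(hs.mul_left _).tsum_mul_right, hs.tsum_mul_left]

/-! ### The spin-boson model -/

lemma isHermitian_pauliX : pauliX.IsHermitian := by
  ext i j
  fin_cases i <;> fin_cases j <;> simp [pauliX]

lemma isHermitian_pauliZ : pauliZ.IsHermitian := by
  ext i j
  fin_cases i <;> fin_cases j <;> simp [pauliZ]

lemma isHermitian_sysHamiltonian (ε Δ : ℝ) : (sysHamiltonian ε Δ).IsHermitian := by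
  rw [Matrix.IsHermitian, sysHamiltonian, Matrix.conjTranspose_add, Matrix.conjTranspose_smul,
    Matrix.conjTranspose_smul, isHermitian_pauliX.eq, isHermitian_pauliZ.eq]
  simp

lemma isBathCorrelation_bathCorr {β : ℝ} {ν : Measure ℝ} {J : ℝ → ℝ} (hβ : 0 < β)
    (hJ : IntegrableOn (fun ω => J ω * coth (β * ω / 2)) (Set.Ioi 0) ν) :
    IsBathCorrelation (bathCorr β ν J) (‖1 / (Real.pi : ℂ)‖
      * ∫ ω in Set.Ioi (0 : ℝ), 2 * ‖J ω * coth (β * ω / 2)‖ ∂ν) where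
  continuous := continuous_bathCorr hβ hJ
  norm_le _ _ := norm_bathCorrStar_le hβ hJ _
  neg := bathCorr_neg

end

end SpinBoson

theorem mainTheorem3 (ε Δ β : ℝ) (hβ : 0 < β)
    (Os : SpinBoson.SysOp) (hOs : Os.IsHermitian)
    (ν : MeasureTheory.Measure ℝ) (J : ℝ → ℝ)
    (hJ : MeasureTheory.IntegrableOn
      (fun ω => J ω * SpinBoson.coth (β * ω / 2)) (Set.Ioi 0) ν)
    (Hs Ws : SpinBoson.SysOp) (hHs : Hs = SpinBoson.sysHamiltonian ε Δ)
    (hWs : Ws = SpinBoson.sysCoupling)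
    (B : ℝ → ℝ → ℂ) (hB : B = SpinBoson.bathCorr β ν J)
    (t : ℝ) (ht : 0 < t) :
    Summable (fun k : ℕ => SpinBoson.dysonTerm Hs Ws Os B (k + 1) t) ∧
    Summable (fun m : {m : ℕ // Odd m} => SpinBoson.memoryTerm Hs Ws Os B m t) ∧
    HasDerivAt (fun τ : ℝ => SpinBoson.propagator Hs Ws Os B τ)
      (Complex.I • (Hs * SpinBoson.propagator Hs Ws Os B t
          - SpinBoson.propagator Hs Ws Os B t * Hs)
        + ∑' m : {m : ℕ // Odd m}, SpinBoson.memoryTerm Hs Ws Os B m t) t := by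
  subst hHs hWs hB
  have hH := SpinBoson.isHermitian_sysHamiltonian ε Δ
  have hW : SpinBoson.sysCoupling.IsHermitian := SpinBoson.isHermitian_pauliZ
  have hB := SpinBoson.isBathCorrelation_bathCorr hβ hJ
  exact ⟨SpinBoson.summable_dysonTerm hH hB ht, (SpinBoson.summable_memoryTerm hH hB ht).subtype _,
    SpinBoson.hasDerivAt_propagator hH hW hOs hB ht⟩
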